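/- **Notation.** Let $\mathbb R_+=[0,\infty)$, $\mathbb R_-=(-\infty,0]$, and let $p,q$ be natural numbers. $L^1(\mathbb R)^{k\times m}$ is the space of $k\times m$ matrix functions with complex Lebesgue integrable entries, $L^1(\mathbb R_\pm)^{k\times m}$ is its subspace of functions supported in $\mathbb R_\pm$, and $L^1(\mathbb R_\pm)^{m}=L^1(\mathbb R_\pm)^{m\times 1}$. $\star$ is the convolution product of matrix functions. For $r\in L^1(\mathbb R)^{k\times m}$ put $r^*(t)=r(-t)^*$, and for $\rho=r_0+r$ with $r_0\in\mathbb C^{k\times m}$ put $\rho^*=r_0^*+r^*$. Write the operator $$L_\rho:L^1(\mathbb R)^m\to L^1(\mathbb R)^k,\qquad (L_\rho f)(t)=r_0f(t)+\int_{-\infty}^{\infty}r(t-s)f(s)\,ds,$$ relative to $L^1(\mathbb R)^\ell=L^1(\mathbb R_-)^\ell\dotplus L^1(\mathbb R_+)^\ell$ ($\ell=m,k$) as $$L_\rho=\begin{bmatrix}T_{-,\rho}&H_{-,\rho}\\ H_{+,\rho}&T_{+,\rho}\end{bmatrix}$$ (so $T_{\pm,\rho}$ are Wiener–Hopf operators and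 $H_{\pm,\rho}$ are Hankel operators). An operator acting on columns is applied to a matrix function column by column. **Theorem 1.1.** Let $g\in L^1(\mathbb R_+)^{p\times q}$, and let $W$ be the operator $$W=\begin{bmatrix} I & H_{+,g}\\ H_{-,g^*} & I\end{bmatrix}\quad\text{on}\quad L^1(\mathbb R_+)^p\oplus L^1(\mathbb R_-)^q .$$ Then $W$ is invertible if and only if $g$ is a solution of a twofold Ellis–Gohberg inverse problem for some data set, i.e. there are $$a\in L^1(\mathbb R_+)^{p\times p},\quad b\in L^1(\mathbb R_+)^{p\times q},\quad c\in L^1(\mathbb R_-)^{q\times p},\quad d\in L^1(\mathbb R_-)^{q\times q}$$ such that $$a+g\star c\in L^1(\mathbb R_-)^{p\times p},\qquad g^*+g^*\star a+c\in L^1(\mathbb R_+)^{q\times p},$$ $$d+g^*\star b\in L^1(\mathbb R_+)^{q\times q},\qquad g+g\star d+b\in L^1(\mathbb R_-)^{p\times q};$$ equivalently, if and only if the two equations $$W\begin{bmatrix}a\\c\end{bmatrix}=\begin{bmatrix}0\\-g^*\end{bmatrix},\qquad W\begin{bmatrix}b\\d\end{bmatrix}=\begin{bmatrix}-g\\0\end{bmatrix}\tag{1}$$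 are solvable with $a,b,c,d$ in the spaces above. In that case, if $a,b,c,d$ are given by (1) and $\alpha=I_p+a$, $\beta=b$, $\gamma=c$, $\delta=I_q+d$, then $$W^{-1}=\begin{bmatrix}M_{11}&M_{12}\\M_{21}&M_{22}\end{bmatrix},$$ where $$M_{11}=T_{+,\alpha}T_{+,\alpha^*}-T_{+,\beta}T_{+,\beta^*},\qquad M_{12}=H_{+,\beta}T_{-,\delta^*}-H_{+,\alpha}T_{-,\gamma^*},$$ $$M_{21}=H_{-,\gamma}T_{+,\alpha^*}-H_{-,\delta}T_{+,\beta^*},\qquad M_{22}=T_{-,\delta}T_{-,\delta^*}-T_{-,\gamma}T_{-,\gamma^*}.$$ Furthermore, $M_{11}$ and $M_{22}$ are invertible and $$H_{+,g}=-M_{11}^{-1}M_{12}=-M_{12}M_{22}^{-1},\qquad H_{-,g^*}=-M_{21}M_{11}^{-1}=-M_{22}^{-1}M_{21},$$ $$g=-M_{11}^{-1}b,\qquad g^*=-M_{22}^{-1}c .$$ -/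

import Mathlib

open MeasureTheory Set

noncomputable section

namespace EllisGohberg

/-! ### Scalar `L¹` functions on the line -/

/-- `L¹(ℝ)`: (classes of) complex valued Lebesgue integrable functions on the real line. -/
abbrev L1R : Type := Lp ℂ 1 (volume : Measure ℝ)

/-- The functions in `L¹(ℝ)` that are supported in `S`, i.e. that vanish almost everywhere
outside `S`. -/
def L1On (S : Set ℝ) : Submodule ℂ L1R where
  carrier := {f | ∀ᵐ t : ℝ, t ∉ S → f t = 0}
  zero_mem' := by
    filter_upwards [Lp.coeFn_zero ℂ 1 (volume : Measure ℝ)] with t ht _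
    exact ht
  add_mem' := by
    intro f g hf hg
    rw [mem_ofPred_eq] at hf hg ⊢
    filter_upwards [Lp.coeFn_add f g, hf, hg] with t ht h1 h2 hS
    rw [ht, Pi.add_apply, h1 hS, h2 hS, add_zero]
  smul_mem' := by
    intro c f hf
    rw [mem_ofPred_eq] at hf ⊢
    filter_upwards [Lp.coeFn_smul c f, hf] with t ht h1 hS
    rw [ht, Pi.smul_apply, h1 hS, smul_zero]

/-- `L¹(ℝ₊)`, where `ℝ₊ = [0, ∞)`. -/
abbrev L1Plus : Submodule ℂ L1R := L1On (Ici 0)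

/-- `L¹(ℝ₋)`, where `ℝ₋ = (-∞, 0]`. -/
abbrev L1Minus : Submodule ℂ L1R := L1On (Iic 0)

/-- The convolution product of two functions in `L¹(ℝ)`. -/
def conv (r f : L1R) : L1R :=
  ((L1.integrable_coeFn r).integrable_convolution (ContinuousLinearMap.mul ℂ ℂ)
    (L1.integrable_coeFn f)).toL1
    (convolution (r : ℝ → ℂ) (f : ℝ → ℂ) (ContinuousLinearMap.mul ℂ ℂ) volume)

theorem conv_ae_eq (r f : L1R) :
    conv r f =ᵐ[volume] fun t : ℝ => ∫ s : ℝ, r (t - s) * f s := by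
  refine (Integrable.coeFn_toL1 _).trans (Filter.Eventually.of_forall fun t => ?_)
  exact convolution_mul_swap

theorem conv_ae_eq_convolution (r f : L1R) :
    conv r f =ᵐ[volume]
      convolution (r : ℝ → ℂ) (f : ℝ → ℂ) (ContinuousLinearMap.mul ℂ ℂ) volume :=
  Integrable.coeFn_toL1 _

theorem conv_add_right (r f f' : L1R) : conv r (f + f') = conv r f + conv r f' := by
  apply Lp.ext
  have e1 := (L1.integrable_coeFn r).ae_convolution_exists (ContinuousLinearMap.mul ℂ ℂ)
    (L1.integrable_coeFn f)
  have e2 := (L1.integrable_coeFn r).ae_convolution_exists (ContinuousLinearMap.mul ℂ ℂ)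
    (L1.integrable_coeFn f')
  filter_upwards [conv_ae_eq_convolution r (f + f'), conv_ae_eq_convolution r f,
    conv_ae_eq_convolution r f', Lp.coeFn_add (conv r f) (conv r f'), e1, e2]
    with t h1 h2 h3 h4 h5 h6
  rw [h1, h4, Pi.add_apply, h2, h3,
    convolution_congr (ContinuousLinearMap.mul ℂ ℂ) (Filter.EventuallyEq.refl _ _)
      (Lp.coeFn_add f f')]
  exact h5.distrib_add h6

theorem conv_smul_right (c : ℂ) (r f : L1R) : conv r (c • f) = c • conv r f := by
  apply Lp.ext
  filter_upwards [conv_ae_eq_convolution r (c • f), conv_ae_eq_convolution r f,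
    Lp.coeFn_smul c (conv r f)] with t h1 h2 h3
  rw [h1, h3, Pi.smul_apply, h2,
    convolution_congr (ContinuousLinearMap.mul ℂ ℂ) (Filter.EventuallyEq.refl _ _)
      (Lp.coeFn_smul c f), convolution_smul, Pi.smul_apply]

theorem norm_conv_le (r f : L1R) : ‖conv r f‖ ≤ ‖r‖ * ‖f‖ := by
  have hr := (L1.integrable_coeFn r).norm
  have hf := (L1.integrable_coeFn f).norm
  rw [L1.norm_eq_integral_norm, L1.norm_eq_integral_norm, L1.norm_eq_integral_norm]
  have key := integral_convolution (μ := (volume : Measure ℝ)) (ν := (volume : Measure ℝ))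
    (ContinuousLinearMap.mul ℝ ℝ) hr hf
  rw [ContinuousLinearMap.mul_apply'] at key
  rw [← key]
  refine integral_mono_ae (L1.integrable_coeFn _).norm
    (hr.integrable_convolution (ContinuousLinearMap.mul ℝ ℝ) hf) ?_
  filter_upwards [conv_ae_eq_convolution r f] with t ht
  rw [ht]
  refine (norm_integral_le_integral_norm _).trans (le_of_eq ?_)
  simp [convolution]

/-- Convolution by `r`, as a bounded linear operator on `L¹(ℝ)`. -/
def convOp (r : L1R) : L1R →L[ℂ] L1R :=
  LinearMap.mkContinuous
    { toFun := conv r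
      map_add' := conv_add_right r
      map_smul' := fun c f => conv_smul_right c r f } ‖r‖ (norm_conv_le r)

/-- The adjoint `f*(t) = conj (f (-t))` of a scalar function. -/
def conjNeg (f : L1R) : L1R :=
  star (Lp.compMeasurePreserving (Neg.neg : ℝ → ℝ)
    (Measure.measurePreserving_neg (volume : Measure ℝ)) f)

theorem conjNeg_ae_eq (f : L1R) :
    conjNeg f =ᵐ[volume] fun t : ℝ => (starRingEnd ℂ) (f (-t)) := by
  filter_upwards [Lp.coeFn_star (Lp.compMeasurePreserving (Neg.neg : ℝ → ℝ)
      (Measure.measurePreserving_neg (volume : Measure ℝ)) f),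
    Lp.coeFn_compMeasurePreserving f (Measure.measurePreserving_neg (volume : Measure ℝ))]
    with t h1 h2
  rw [conjNeg, h1, Pi.star_apply, h2]
  rfl

theorem conjNeg_mem_minus {f : L1R} (hf : f ∈ L1Plus) : conjNeg f ∈ L1Minus := by
  have h : ∀ᵐ t : ℝ, -t ∉ Ici (0 : ℝ) → f (-t) = 0 :=
    (Measure.measurePreserving_neg (volume : Measure ℝ)).quasiMeasurePreserving.ae hf
  filter_upwards [conjNeg_ae_eq f, h] with t h1 h2 h3
  rw [h1, h2 (by simpa using h3), map_zero]

/-- The product of `f ∈ L¹(ℝ)` with the indicator function of `S`. -/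
def indic (S : Set ℝ) (hS : MeasurableSet S) (f : L1R) : L1R :=
  ((L1.integrable_coeFn f).indicator hS).toL1 (S.indicator (f : ℝ → ℂ))

theorem indic_ae_eq (S : Set ℝ) (hS : MeasurableSet S) (f : L1R) :
    indic S hS f =ᵐ[volume] S.indicator (f : ℝ → ℂ) :=
  Integrable.coeFn_toL1 _

theorem indic_mem (S : Set ℝ) (hS : MeasurableSet S) (f : L1R) : indic S hS f ∈ L1On S := by
  change ∀ᵐ t : ℝ, t ∉ S → indic S hS f t = 0
  filter_upwards [indic_ae_eq S hS f] with t ht h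
  rw [ht, indicator_of_notMem h]

theorem indic_add (S : Set ℝ) (hS : MeasurableSet S) (f g : L1R) :
    indic S hS (f + g) = indic S hS f + indic S hS g := by
  apply Lp.ext
  filter_upwards [indic_ae_eq S hS (f + g), indic_ae_eq S hS f, indic_ae_eq S hS g,
    Lp.coeFn_add (indic S hS f) (indic S hS g), Lp.coeFn_add f g] with t h1 h2 h3 h4 h5
  rw [h1, h4, Pi.add_apply, h2, h3]
  by_cases h : t ∈ S
  · simp only [indicator_of_mem h, h5, Pi.add_apply]
  · simp only [indicator_of_notMem h, add_zero]

theorem indic_smul (S : Set ℝ) (hS : MeasurableSet S) (c : ℂ) (f : L1R) :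
    indic S hS (c • f) = c • indic S hS f := by
  apply Lp.ext
  filter_upwards [indic_ae_eq S hS (c • f), indic_ae_eq S hS f,
    Lp.coeFn_smul c (indic S hS f), Lp.coeFn_smul c f] with t h1 h2 h3 h4
  rw [h1, h3, Pi.smul_apply, h2]
  by_cases h : t ∈ S
  · simp only [indicator_of_mem h, h4, Pi.smul_apply]
  · simp only [indicator_of_notMem h, smul_zero]

theorem norm_indic_le (S : Set ℝ) (hS : MeasurableSet S) (f : L1R) : ‖indic S hS f‖ ≤ ‖f‖ := by
  rw [L1.norm_eq_integral_norm, L1.norm_eq_integral_norm]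
  refine integral_mono_ae (L1.integrable_coeFn _).norm (L1.integrable_coeFn f).norm ?_
  filter_upwards [indic_ae_eq S hS f] with t ht
  rw [ht]
  exact norm_indicator_le_norm_self _ _

/-- Multiplication by the indicator function of `S`, as a bounded operator from `L¹(ℝ)` onto the
space of functions supported in `S`. -/
def restr (S : Set ℝ) (hS : MeasurableSet S) : L1R →L[ℂ] L1On S :=
  ContinuousLinearMap.codRestrict
    (LinearMap.mkContinuous
      { toFun := indic S hS
        map_add' := indic_add S hS
        map_smul' := indic_smul S hS } 1
      (fun f => (norm_indic_le S hS f).trans (one_mul ‖f‖).ge))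
    (L1On S) (indic_mem S hS)

/-! ### Matrix functions -/

/-- `L¹(ℝ)^{k×m}`. -/
abbrev L1Mat (k m : ℕ) : Type := Matrix (Fin k) (Fin m) L1R

/-- `L¹(ℝ₊)^{k×m}`. -/
abbrev L1PlusMat (k m : ℕ) : Type := Matrix (Fin k) (Fin m) L1Plus

/-- `L¹(ℝ₋)^{k×m}`. -/
abbrev L1MinusMat (k m : ℕ) : Type := Matrix (Fin k) (Fin m) L1Minus

/-- A matrix function supported in `S`, regarded as a matrix function on the whole line. -/
def incl {S : Set ℝ} {k m : ℕ} (f : Matrix (Fin k) (Fin m) (L1On S)) : L1Mat k m :=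
  Matrix.of fun i j => (f i j : L1R)

/-- All the entries of the matrix function `f` are supported in `S`. -/
def SuppIn (S : Set ℝ) {k m : ℕ} (f : L1Mat k m) : Prop := ∀ i j, f i j ∈ L1On S

/-- The convolution product of matrix functions. -/
def mconv {k l m : ℕ} (f : L1Mat k l) (h : L1Mat l m) : L1Mat k m :=
  Matrix.of fun i j => ∑ n, conv (f i n) (h n j)

/-- The adjoint `f*(t) = (f (-t))ᴴ` of a matrix function. -/
def adj {k m : ℕ} (f : L1Mat k m) : L1Mat m k :=
  Matrix.of fun i j => conjNeg (f j i)

/-- The adjoint `g* ∈ L¹(ℝ₋)^{q×p}` of `g ∈ L¹(ℝ₊)^{p×q}`. -/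
def adjPlus {p q : ℕ} (g : L1PlusMat p q) : L1MinusMat q p :=
  Matrix.of fun i j => ⟨conjNeg (g j i : L1R), conjNeg_mem_minus (g j i).2⟩

/-- `g` solves the twofold Ellis–Gohberg inverse problem with data set `{a, b, c, d}`. -/
structure IsEGSolution {p q : ℕ} (a : L1PlusMat p p) (b : L1PlusMat p q)
    (c : L1MinusMat q p) (d : L1MinusMat q q) (g : L1PlusMat p q) : Prop where
  inclusion_a : SuppIn (Iic 0) (incl a + mconv (incl g) (incl c))
  inclusion_c : SuppIn (Ici 0) (adj (incl g) + mconv (adj (incl g)) (incl a) + incl c)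
  inclusion_d : SuppIn (Ici 0) (incl d + mconv (adj (incl g)) (incl b))
  inclusion_b : SuppIn (Iic 0) (incl g + mconv (incl g) (incl d) + incl b)

/-! ### Laurent, Wiener–Hopf and Hankel operators -/

/-- A function `ρ(t) = r₀ + r(t)` with `r₀ ∈ ℂ^{k×m}` and `r ∈ L¹(ℝ)^{k×m}`. -/
structure MatSymbol (k m : ℕ) where
  const : Matrix (Fin k) (Fin m) ℂ
  fn : L1Mat k m

/-- The adjoint `ρ*(t) = (ρ (-t))ᴴ = r₀ᴴ + r*(t)`. -/
def MatSymbol.adjoint {k m : ℕ} (ρ : MatSymbol k m) : MatSymbol m k :=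
  ⟨ρ.const.conjTranspose, adj ρ.fn⟩

/-- A matrix function in `L¹`, regarded as a function `ρ` without constant term. -/
def MatSymbol.ofL1 {k m : ℕ} (r : L1Mat k m) : MatSymbol k m := ⟨0, r⟩

/-- The function `e + r`, where `e` is constantly equal to the unit matrix. -/
def MatSymbol.oneAdd {k : ℕ} (r : L1Mat k k) : MatSymbol k k := ⟨1, r⟩

/-- The Laurent operator `(L_ρ f)(t) = r₀ f(t) + ∫ r(t - s) f(s) ds`. -/
def laurent {k m : ℕ} (ρ : MatSymbol k m) : (Fin m → L1R) →L[ℂ] (Fin k → L1R) :=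
  ContinuousLinearMap.pi fun i =>
    ∑ j, (ρ.const i j • ContinuousLinearMap.id ℂ L1R + convOp (ρ.fn i j)).comp
      (ContinuousLinearMap.proj (R := ℂ) (φ := fun _ : Fin m => L1R) j)

/-- The block of the Laurent operator `L_ρ` that maps functions supported in `S` to functions
supported in `S'`. -/
def block (S S' : Set ℝ) (hS' : MeasurableSet S') {k m : ℕ} (ρ : MatSymbol k m) :
    (Fin m → L1On S) →L[ℂ] (Fin k → L1On S') :=
  (ContinuousLinearMap.pi fun i => (restr S' hS').comp
      (ContinuousLinearMap.proj (R := ℂ) (φ := fun _ : Fin k => L1R) i)).comp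
    ((laurent ρ).comp
      (ContinuousLinearMap.pi fun j => (L1On S).subtypeL.comp
        (ContinuousLinearMap.proj (R := ℂ) (φ := fun _ : Fin m => L1On S) j)))

/-- The Wiener–Hopf operator `T_{+,ρ} : L¹(ℝ₊)^m → L¹(ℝ₊)^k`. -/
def Tplus {k m : ℕ} (ρ : MatSymbol k m) : (Fin m → L1Plus) →L[ℂ] (Fin k → L1Plus) :=
  block (Ici 0) (Ici 0) measurableSet_Ici ρ

/-- The Wiener–Hopf operator `T_{-,ρ} : L¹(ℝ₋)^m → L¹(ℝ₋)^k`. -/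
def Tminus {k m : ℕ} (ρ : MatSymbol k m) : (Fin m → L1Minus) →L[ℂ] (Fin k → L1Minus) :=
  block (Iic 0) (Iic 0) measurableSet_Iic ρ

/-- The Hankel operator `H_{+,ρ} : L¹(ℝ₋)^m → L¹(ℝ₊)^k`. -/
def Hplus {k m : ℕ} (ρ : MatSymbol k m) : (Fin m → L1Minus) →L[ℂ] (Fin k → L1Plus) :=
  block (Iic 0) (Ici 0) measurableSet_Ici ρ

/-- The Hankel operator `H_{-,ρ} : L¹(ℝ₊)^m → L¹(ℝ₋)^k`. -/
def Hminus {k m : ℕ} (ρ : MatSymbol k m) : (Fin m → L1Plus) →L[ℂ] (Fin k → L1Minus) :=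
  block (Ici 0) (Iic 0) measurableSet_Iic ρ

/-! ### Block operators and the operators of the theorem -/

/-- The space `L¹(ℝ₊)^p ⊕ L¹(ℝ₋)^q`. -/
abbrev Space (p q : ℕ) : Type := (Fin p → L1Plus) × (Fin q → L1Minus)

/-- The operator with block matrix `[[A, B], [C, D]]`. -/
def blockOp {p q : ℕ}
    (A : (Fin p → L1Plus) →L[ℂ] (Fin p → L1Plus))
    (B : (Fin q → L1Minus) →L[ℂ] (Fin p → L1Plus))
    (C : (Fin p → L1Plus) →L[ℂ] (Fin q → L1Minus))
    (D : (Fin q → L1Minus) →L[ℂ] (Fin q → L1Minus)) :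
    Space p q →L[ℂ] Space p q :=
  (A.comp (ContinuousLinearMap.fst ℂ _ _) + B.comp (ContinuousLinearMap.snd ℂ _ _)).prod
    (C.comp (ContinuousLinearMap.fst ℂ _ _) + D.comp (ContinuousLinearMap.snd ℂ _ _))

/-- The Hankel operator `H_{+,g}`. -/
def Hg {p q : ℕ} (g : L1PlusMat p q) : (Fin q → L1Minus) →L[ℂ] (Fin p → L1Plus) :=
  Hplus (MatSymbol.ofL1 (incl g))

/-- The Hankel operator `H_{-,g*}`. -/
def HgStar {p q : ℕ} (g : L1PlusMat p q) : (Fin p → L1Plus) →L[ℂ] (Fin q → L1Minus) :=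
  Hminus (MatSymbol.ofL1 (adj (incl g)))

/-- The operator `W = [[I, H_{+,g}], [H_{-,g*}, I]]`. -/
def W {p q : ℕ} (g : L1PlusMat p q) : Space p q →L[ℂ] Space p q :=
  blockOp (ContinuousLinearMap.id ℂ _) (Hg g) (HgStar g) (ContinuousLinearMap.id ℂ _)

/-- An operator acting on columns, extended to matrices column by column. -/
def onCols {X Y : Submodule ℂ L1R} {k l m : ℕ} (T : (Fin k → X) →L[ℂ] (Fin l → Y))
    (F : Matrix (Fin k) (Fin m) X) : Matrix (Fin l) (Fin m) Y :=
  Matrix.of fun i j => T (fun n => F n j) i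

/-- `T [x; y] = [u; v]` for matrix functions `x, y, u, v` with `m` columns, the operator `T`
acting on each column. -/
def BlockEq {p q m : ℕ} (T : Space p q →L[ℂ] Space p q)
    (x : L1PlusMat p m) (y : L1MinusMat q m) (u : L1PlusMat p m) (v : L1MinusMat q m) : Prop :=
  ∀ j, T (fun i => x i j, fun i => y i j) = (fun i => u i j, fun i => v i j)

section Operators

variable {p q : ℕ} (a : L1PlusMat p p) (b : L1PlusMat p q) (c : L1MinusMat q p)
  (d : L1MinusMat q q)

/-- `α = e_p + a`. -/
def symA : MatSymbol p p := MatSymbol.oneAdd (incl a)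

/-- `β = b`. -/
def symB : MatSymbol p q := MatSymbol.ofL1 (incl b)

/-- `γ = c`. -/
def symC : MatSymbol q p := MatSymbol.ofL1 (incl c)

/-- `δ = e_q + d`. -/
def symD : MatSymbol q q := MatSymbol.oneAdd (incl d)

/-- `M₁₁ = T_{+,α} T_{+,α*} - T_{+,β} T_{+,β*}`. -/
def M11 : (Fin p → L1Plus) →L[ℂ] (Fin p → L1Plus) :=
  Tplus (symA a) ∘L Tplus (symA a).adjoint - Tplus (symB b) ∘L Tplus (symB b).adjoint

/-- `M₂₁ = H_{-,γ} T_{+,α*} - H_{-,δ} T_{+,β*}`. -/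
def M21 : (Fin p → L1Plus) →L[ℂ] (Fin q → L1Minus) :=
  Hminus (symC c) ∘L Tplus (symA a).adjoint - Hminus (symD d) ∘L Tplus (symB b).adjoint

/-- `M₁₂ = H_{+,β} T_{-,δ*} - H_{+,α} T_{-,γ*}`. -/
def M12 : (Fin q → L1Minus) →L[ℂ] (Fin p → L1Plus) :=
  Hplus (symB b) ∘L Tminus (symD d).adjoint - Hplus (symA a) ∘L Tminus (symC c).adjoint

/-- `M₂₂ = T_{-,δ} T_{-,δ*} - T_{-,γ} T_{-,γ*}`. -/
def M22 : (Fin q → L1Minus) →L[ℂ] (Fin q → L1Minus) :=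
  Tminus (symD d) ∘L Tminus (symD d).adjoint - Tminus (symC c) ∘L Tminus (symC c).adjoint

end Operators

end EllisGohberg

end

open EllisGohberg

noncomputable section

namespace EllisGohberg

/-! ### The convolution algebra `L¹(ℝ)` -/

/-! The unitization `Wiener` of `L¹(ℝ)` under convolution is a commutative star ring, and Laurent
operators multiply like their symbols (`Wiener.op_mul`, `WMat.op_mul`). In it the Ellis–Gohberg
inclusions say that `α + gγ`, `β + gδ` lie in `ℂ + L¹(ℝ₋)` and `γ + g*α`, `δ + g*β` in `ℂ + L¹(ℝ₊)`,
entrywise. These two subalgebras meet only in the constants.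

Hence `α*α - γ*γ = α*(α + gγ) - (γ + g*α)*γ`, which is selfadjoint and lies in the minus algebra, is
constant and equal to `1`. In the same way `δ*δ - β*β = 1` and `α*β = γ*δ`. So the square matrix
with blocks `α, β, γ, δ` has a one-sided inverse built from adjoints. Over a commutative ring that
inverse is two-sided, which gives `αα* - ββ* = 1`, `δδ* - γγ* = 1`, `αγ* = βδ*`
(`SymbolData.fromBlocks_mul`).

Compressing to the half-lines, a product of symbols becomes a product of 2×2 block matrices
(`WMat.blk_mul`), and a symbol in the plus or minus algebra is block triangular. The identities then
show that the block operator with entries `M₁₁, M₁₂, M₂₁, M₂₂` is a right inverse of `W` and, after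
rewriting `M₁₂` and `M₂₁` by `WMat.offdiag_eq`, also a left inverse.

The inclusions are the two linear equations for `W` in disguise (`isEGSolution_iff`), so an
invertible `W` yields data. The remaining formulas are read off from the entries of the two inverse
relations. -/

theorem conv_comm (r f : L1R) : conv r f = conv f r := by
  apply Lp.ext
  filter_upwards [conv_ae_eq_convolution r f, conv_ae_eq_convolution f r] with t h1 h2
  rw [h1, h2, ← convolution_flip]
  congr 1
  ext
  simp

theorem conv_add_left (r r' f : L1R) : conv (r + r') f = conv r f + conv r' f := by
  rw [conv_comm, conv_add_right, conv_comm f r, conv_comm f r']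

theorem conv_smul_left (c : ℂ) (r f : L1R) : conv (c • r) f = c • conv r f := by
  rw [conv_comm, conv_smul_right, conv_comm]

theorem conv_assoc (r f h : L1R) : conv (conv r f) h = conv r (conv f h) := by
  apply Lp.ext
  have ir := L1.integrable_coeFn r
  have jf := L1.integrable_coeFn f
  have ih := L1.integrable_coeFn h
  filter_upwards [conv_ae_eq_convolution (conv r f) h, conv_ae_eq_convolution r (conv f h),
    ir.norm.ae_convolution_exists (ContinuousLinearMap.mul ℝ ℝ)
      (jf.norm.integrable_convolution (ContinuousLinearMap.mul ℝ ℝ) ih.norm)] with t h1 h2 h3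
  rw [h1, h2,
    convolution_congr _ (conv_ae_eq_convolution r f) (Filter.EventuallyEq.refl _ _),
    convolution_congr _ (Filter.EventuallyEq.refl _ _) (conv_ae_eq_convolution f h)]
  exact convolution_assoc _ _ _ _ (fun x y z => by simp [mul_assoc])
    ir.aestronglyMeasurable jf.aestronglyMeasurable ih.aestronglyMeasurable
    (ir.ae_convolution_exists _ jf) (jf.norm.ae_convolution_exists _ ih.norm) h3

theorem conjNeg_conv (r f : L1R) : conjNeg (conv r f) = conv (conjNeg r) (conjNeg f) := by
  apply Lp.ext
  have hneg : ∀ᵐ t : ℝ, conv r f (-t) = ∫ s : ℝ, r (-t - s) * f s :=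
    (Measure.measurePreserving_neg (volume : Measure ℝ)).quasiMeasurePreserving.ae
      (conv_ae_eq r f)
  filter_upwards [conjNeg_ae_eq (conv r f), hneg, conv_ae_eq_convolution (conjNeg r) (conjNeg f)]
    with t h1 h2 h3
  -- The substitution `s ↦ -s` matches the two integrals.
  rw [h1, h2, h3, convolution_congr _ (conjNeg_ae_eq r) (conjNeg_ae_eq f), convolution_mul_swap,
    ← integral_conj, ← integral_neg_eq_self]
  congr 1
  ext s
  rw [map_mul, show -t - -s = -(t - s) by ring]

theorem conjNeg_conjNeg (f : L1R) : conjNeg (conjNeg f) = f := by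
  apply Lp.ext
  have hneg : ∀ᵐ t : ℝ, conjNeg f (-t) = (starRingEnd ℂ) (f (- -t)) :=
    (Measure.measurePreserving_neg (volume : Measure ℝ)).quasiMeasurePreserving.ae
      (conjNeg_ae_eq f)
  filter_upwards [conjNeg_ae_eq (conjNeg f), hneg] with t h1 h2
  rw [h1, h2, neg_neg, Complex.conj_conj]

theorem conjNeg_add (f h : L1R) : conjNeg (f + h) = conjNeg f + conjNeg h := by
  apply Lp.ext
  have hneg : ∀ᵐ t : ℝ, (f + h : L1R) (-t) = f (-t) + h (-t) :=
    (Measure.measurePreserving_neg (volume : Measure ℝ)).quasiMeasurePreserving.ae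
      (Lp.coeFn_add f h)
  filter_upwards [conjNeg_ae_eq (f + h), conjNeg_ae_eq f, conjNeg_ae_eq h, hneg,
    Lp.coeFn_add (conjNeg f) (conjNeg h)] with t h1 h2 h3 h4 h5
  rw [h1, h5, Pi.add_apply, h2, h3, h4, map_add]

theorem conjNeg_smul (c : ℂ) (f : L1R) : conjNeg (c • f) = star c • conjNeg f := by
  apply Lp.ext
  have hneg : ∀ᵐ t : ℝ, (c • f : L1R) (-t) = c * f (-t) :=
    (Measure.measurePreserving_neg (volume : Measure ℝ)).quasiMeasurePreserving.ae
      (Lp.coeFn_smul c f)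
  filter_upwards [conjNeg_ae_eq (c • f), conjNeg_ae_eq f, hneg,
    Lp.coeFn_smul (star c) (conjNeg f)] with t h1 h2 h3 h4
  rw [h1, h4, Pi.smul_apply, h2, h3, map_mul, smul_eq_mul]
  rfl

/-! ### Supports in the half-lines -/

theorem conjNeg_mem_plus {f : L1R} (hf : f ∈ L1Minus) : conjNeg f ∈ L1Plus := by
  have h : ∀ᵐ t : ℝ, -t ∉ Iic (0 : ℝ) → f (-t) = 0 :=
    (Measure.measurePreserving_neg (volume : Measure ℝ)).quasiMeasurePreserving.ae hf
  filter_upwards [conjNeg_ae_eq f, h] with t h1 h2 h3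
  rw [h1, h2 (by simpa using h3), map_zero]

/-- For `t ∉ U` the integrand `r (t - s) * f s` vanishes for almost every `s`: `t - s ∈ S` and `s ∈
T` together would put `t` in `U`. -/
theorem conv_mem_L1On {S T U : Set ℝ} (hSTU : ∀ s ∈ S, ∀ t ∈ T, s + t ∈ U) {r f : L1R}
    (hr : r ∈ L1On S) (hf : f ∈ L1On T) : conv r f ∈ L1On U := by
  change ∀ᵐ t : ℝ, t ∉ U → conv r f t = 0
  filter_upwards [conv_ae_eq r f] with t ht htU
  rw [ht]
  apply integral_eq_zero_of_ae
  have hr' : ∀ᵐ s : ℝ, t - s ∉ S → r (t - s) = 0 :=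
    (quasiMeasurePreserving_sub_left_of_right_invariant (volume : Measure ℝ) t).ae hr
  filter_upwards [hr', show ∀ᵐ s : ℝ, s ∉ T → f s = 0 from hf] with s h1 h2
  by_cases hs : s ∈ T
  · rw [h1 fun h => htU (by simpa using hSTU _ h _ hs), zero_mul, Pi.zero_apply]
  · rw [h2 hs, mul_zero, Pi.zero_apply]

theorem conv_mem_plus {r f : L1R} (hr : r ∈ L1Plus) (hf : f ∈ L1Plus) : conv r f ∈ L1Plus :=
  conv_mem_L1On (fun _ hs _ ht => add_nonneg (mem_Ici.1 hs) (mem_Ici.1 ht)) hr hf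

theorem conv_mem_minus {r f : L1R} (hr : r ∈ L1Minus) (hf : f ∈ L1Minus) : conv r f ∈ L1Minus :=
  conv_mem_L1On (fun _ hs _ ht => add_nonpos (mem_Iic.1 hs) (mem_Iic.1 ht)) hr hf

theorem eq_zero_of_mem_plus_of_mem_minus {f : L1R} (hp : f ∈ L1Plus) (hm : f ∈ L1Minus) :
    f = 0 := by
  apply Lp.ext
  filter_upwards [show ∀ᵐ t : ℝ, t ∉ Ici 0 → f t = 0 from hp,
    show ∀ᵐ t : ℝ, t ∉ Iic 0 → f t = 0 from hm, Lp.coeFn_zero ℂ 1 (volume : Measure ℝ),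
    compl_mem_ae_iff.2 (measure_singleton (μ := volume) (0 : ℝ))] with t h1 h2 h3 h4
  rw [h3, Pi.zero_apply]
  rcases lt_or_gt_of_ne (show t ≠ 0 from h4) with h | h
  · exact h1 (by simpa using h)
  · exact h2 (by simpa using h)

/-! ### The Wiener algebra -/

/-- `L¹(ℝ)` as an algebra with the convolution product and the involution `f ↦ f*`. -/
def ConvL1 : Type := L1R

namespace ConvL1

instance : AddCommGroup ConvL1 := inferInstanceAs (AddCommGroup L1R)

instance : Module ℂ ConvL1 := inferInstanceAs (Module ℂ L1R)

instance : NonUnitalCommRing ConvL1 :=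
  { (inferInstance : AddCommGroup ConvL1) with
    mul := conv
    left_distrib := conv_add_right
    right_distrib := conv_add_left
    zero_mul := fun f => by
      have h := conv_smul_left 0 0 f
      rwa [zero_smul, zero_smul] at h
    mul_zero := fun f => by
      have h := conv_smul_right 0 f 0
      rwa [zero_smul, zero_smul] at h
    mul_assoc := conv_assoc
    mul_comm := conv_comm }

instance : IsScalarTower ℂ ConvL1 ConvL1 := ⟨conv_smul_left⟩

instance : SMulCommClass ℂ ConvL1 ConvL1 := ⟨fun c r f => (conv_smul_right c r f).symm⟩

instance : StarRing ConvL1 where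
  star := conjNeg
  star_involutive := conjNeg_conjNeg
  star_mul r f := (conjNeg_conv r f).trans (conv_comm _ _)
  star_add := conjNeg_add

instance : StarModule ℂ ConvL1 := ⟨conjNeg_smul⟩

end ConvL1

/-- The Wiener algebra `ℂ + L¹(ℝ)`. -/
abbrev Wiener : Type := Unitization ℂ ConvL1

namespace Wiener

/-- The function `r` in `r₀ + r`. -/
def fn (x : Wiener) : L1R := x.snd

theorem fn_zero : fn 0 = 0 := rfl

theorem fn_one : fn 1 = 0 := rfl

theorem fn_add (x y : Wiener) : fn (x + y) = fn x + fn y := rfl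

theorem fn_mul (x y : Wiener) : fn (x * y) = x.fst • fn y + y.fst • fn x + conv (fn x) (fn y) :=
  rfl

/-- The elements `r₀ + r` of the Wiener algebra with `r` in the non-unital subalgebra `X`. -/
def subring (X : Submodule ℂ L1R) (hX : ∀ r ∈ X, ∀ f ∈ X, conv r f ∈ X) : Subring Wiener where
  carrier := {x | fn x ∈ X}
  zero_mem' := X.zero_mem
  one_mem' := X.zero_mem
  add_mem' := X.add_mem
  neg_mem' := X.neg_mem
  mul_mem' {x y} hx hy :=
    X.add_mem (X.add_mem (X.smul_mem x.fst hy) (X.smul_mem y.fst hx)) (hX _ hx _ hy)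

/-- `ℂ + L¹(ℝ₊)`. -/
def plus : Subring Wiener := subring L1Plus fun _ hr _ hf => conv_mem_plus hr hf

/-- `ℂ + L¹(ℝ₋)`. -/
def minus : Subring Wiener := subring L1Minus fun _ hr _ hf => conv_mem_minus hr hf

theorem star_mem_minus {x : Wiener} (hx : x ∈ plus) : star x ∈ minus := conjNeg_mem_minus hx

theorem star_mem_plus {x : Wiener} (hx : x ∈ minus) : star x ∈ plus := conjNeg_mem_plus hx

/-- The `L¹` part is supported in both half-lines, hence at the null set `{0}`. This Liouville-type
fact turns the inclusions into identities. -/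
theorem eq_inl_of_mem {x : Wiener} (hp : x ∈ plus) (hm : x ∈ minus) :
    x = Unitization.inl x.fst :=
  Unitization.ext rfl (eq_zero_of_mem_plus_of_mem_minus hp hm)

/-- The operator of multiplication by `x` on `L¹(ℝ)`. -/
def op (x : Wiener) : L1R →L[ℂ] L1R := x.fst • ContinuousLinearMap.id ℂ L1R + convOp (fn x)

theorem op_apply (x : Wiener) (f : L1R) : op x f = x.fst • f + conv (fn x) f := rfl

theorem op_one : op 1 = ContinuousLinearMap.id ℂ L1R := by
  ext1 f
  rw [op_apply]
  have h := conv_smul_left 0 0 f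
  rw [zero_smul, zero_smul] at h
  rw [fn_one, h, Unitization.fst_one, one_smul, add_zero]
  rfl

theorem op_zero : op 0 = 0 := by
  ext1 f
  rw [op_apply]
  have h := conv_smul_left 0 0 f
  rw [zero_smul, zero_smul] at h
  rw [fn_zero, h, Unitization.fst_zero, zero_smul, add_zero]
  rfl

theorem op_add (x y : Wiener) : op (x + y) = op x + op y := by
  ext1 f
  rw [add_apply]
  simp only [op_apply, fn_add, Unitization.fst_add, conv_add_left, add_smul]
  abel

/-- Associativity of convolution; it lets identities between symbols pass to operators. -/
theorem op_mul (x y : Wiener) : op (x * y) = op x ∘L op y := by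
  ext1 f
  rw [ContinuousLinearMap.comp_apply]
  simp only [op_apply, fn_mul, Unitization.fst_mul, conv_add_left, conv_smul_left, conv_assoc,
    conv_add_right, conv_smul_right, smul_add, mul_smul]
  abel

theorem op_sum {ι : Type*} (s : Finset ι) (x : ι → Wiener) :
    op (∑ i ∈ s, x i) = ∑ i ∈ s, op (x i) :=
  map_sum (⟨⟨op, op_zero⟩, op_add⟩ : Wiener →+ (L1R →L[ℂ] L1R)) x s

end Wiener

end EllisGohberg

namespace EllisGohberg

/-! ### Laurent operators with symbols over the Wiener algebra -/

/-- Matrices over the Wiener algebra. -/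
abbrev WMat (k m : ℕ) : Type := Matrix (Fin k) (Fin m) Wiener

/-- The symbol `r₀ + r` as a matrix over the Wiener algebra. -/
def MatSymbol.toWMat {k m : ℕ} (ρ : MatSymbol k m) : WMat k m :=
  Matrix.of fun i j => ⟨(ρ.const i j, ρ.fn i j)⟩

theorem MatSymbol.toWMat_adjoint {k m : ℕ} (ρ : MatSymbol k m) :
    ρ.adjoint.toWMat = ρ.toWMat.conjTranspose := rfl

namespace WMat

variable {k l m : ℕ}

/-- The Laurent operator with symbol `x`. -/
def op (x : WMat k m) : (Fin m → L1R) →L[ℂ] (Fin k → L1R) :=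
  ContinuousLinearMap.pi fun i =>
    ∑ j, (Wiener.op (x i j)).comp
      (ContinuousLinearMap.proj (R := ℂ) (φ := fun _ : Fin m => L1R) j)

theorem op_apply (x : WMat k m) (f : Fin m → L1R) (i : Fin k) :
    op x f i = ∑ j, Wiener.op (x i j) (f j) := by
  simp [op, sum_apply]

theorem op_add (x y : WMat k m) : op (x + y) = op x + op y := by
  ext1 f
  funext i
  rw [add_apply, Pi.add_apply]
  simp only [op_apply, Matrix.add_apply, Wiener.op_add, add_apply, Finset.sum_add_distrib]

theorem op_one : op (1 : WMat k k) = ContinuousLinearMap.id ℂ _ := by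
  ext1 f
  funext i
  rw [op_apply, Finset.sum_eq_single i]
  · rw [Matrix.one_apply_eq, Wiener.op_one]
    rfl
  · intro j _ hj
    rw [Matrix.one_apply_ne hj.symm, Wiener.op_zero]
    rfl
  · exact fun h => absurd (Finset.mem_univ i) h

theorem op_mul (x : WMat k l) (y : WMat l m) : op (x * y) = op x ∘L op y := by
  ext1 f
  funext i
  rw [ContinuousLinearMap.comp_apply]
  simp only [op_apply, Matrix.mul_apply, Wiener.op_sum, Wiener.op_mul, sum_apply,
    ContinuousLinearMap.comp_apply, map_sum]
  exact Finset.sum_comm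

end WMat

/-! ### Compressions to half-lines -/

/-- Multiplication by the indicator function of `S`, on columns. -/
def restrCols (S : Set ℝ) (hS : MeasurableSet S) (k : ℕ) :
    (Fin k → L1R) →L[ℂ] (Fin k → L1On S) :=
  ContinuousLinearMap.pi fun i => (restr S hS).comp
    (ContinuousLinearMap.proj (R := ℂ) (φ := fun _ : Fin k => L1R) i)

/-- The inclusion of the columns supported in `S`. -/
def inclCols (S : Set ℝ) (k : ℕ) : (Fin k → L1On S) →L[ℂ] (Fin k → L1R) :=
  ContinuousLinearMap.pi fun j => (L1On S).subtypeL.comp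
    (ContinuousLinearMap.proj (R := ℂ) (φ := fun _ : Fin k => L1On S) j)

theorem indic_of_mem {S : Set ℝ} (hS : MeasurableSet S) {f : L1R} (hf : f ∈ L1On S) :
    indic S hS f = f := by
  apply Lp.ext
  filter_upwards [indic_ae_eq S hS f, show ∀ᵐ t : ℝ, t ∉ S → f t = 0 from hf] with t h1 h2
  rw [h1]
  by_cases h : t ∈ S
  · exact indicator_of_mem h _
  · rw [indicator_of_notMem h, h2 h]

theorem restrCols_inclCols {S : Set ℝ} (hS : MeasurableSet S) {k : ℕ} (f : Fin k → L1On S) :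
    restrCols S hS k (inclCols S k f) = f := by
  funext i
  exact Subtype.ext (indic_of_mem hS (f i).2)

/-- `L¹(ℝ) = L¹(S) ∔ L¹(S')`, by restriction to `S` and to `S'`. -/
def Splits (S S' : Set ℝ) (hS : MeasurableSet S) (hS' : MeasurableSet S') : Prop :=
  ∀ f : L1R, indic S hS f + indic S' hS' f = f

/-- The half-lines overlap only at `0`, a null set. -/
theorem splits_Ici_Iic : Splits (Ici 0) (Iic 0) measurableSet_Ici measurableSet_Iic := by
  intro f
  apply Lp.ext
  filter_upwards [indic_ae_eq (Ici 0) measurableSet_Ici f, indic_ae_eq (Iic 0) measurableSet_Iic f,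
    Lp.coeFn_add (indic (Ici 0) measurableSet_Ici f) (indic (Iic 0) measurableSet_Iic f),
    compl_mem_ae_iff.2 (measure_singleton (μ := volume) (0 : ℝ))] with t h1 h2 h3 h4
  rw [h3, Pi.add_apply, h1, h2]
  rcases lt_or_gt_of_ne (show t ≠ 0 from h4) with h | h
  · rw [indicator_of_notMem (by simpa using h), indicator_of_mem (by simpa using h.le), zero_add]
  · rw [indicator_of_mem (by simpa using h.le), indicator_of_notMem (by simpa using h), add_zero]

theorem Splits.symm {S S' : Set ℝ} {hS : MeasurableSet S} {hS' : MeasurableSet S'}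
    (h : Splits S S' hS hS') : Splits S' S hS' hS :=
  fun f => (add_comm _ _).trans (h f)

theorem Splits.inclCols_add {S S' : Set ℝ} {hS : MeasurableSet S} {hS' : MeasurableSet S'}
    (h : Splits S S' hS hS') {k : ℕ} (f : Fin k → L1R) :
    inclCols S k (restrCols S hS k f) + inclCols S' k (restrCols S' hS' k f) = f := by
  funext i
  exact h (f i)

theorem indic_eq_zero_iff {S S' : Set ℝ} {hS : MeasurableSet S} {hS' : MeasurableSet S'}
    (h : Splits S S' hS hS') (f : L1R) : indic S' hS' f = 0 ↔ f ∈ L1On S := by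
  refine ⟨fun h0 => ?_, fun hf => ?_⟩
  · have := h f
    rw [h0, add_zero] at this
    rw [← this]
    exact indic_mem S hS f
  · have := h f
    rwa [indic_of_mem hS hf, add_eq_left] at this

namespace WMat

/-- The block of the Laurent operator `op x` from functions supported in `S` to functions
supported in `S'`. -/
def blk (S S' : Set ℝ) (hS' : MeasurableSet S') {k m : ℕ} (x : WMat k m) :
    (Fin m → L1On S) →L[ℂ] (Fin k → L1On S') :=
  (restrCols S' hS' k).comp ((op x).comp (inclCols S m))

theorem _root_.EllisGohberg.block_eq_blk (S S' : Set ℝ) (hS' : MeasurableSet S') {k m : ℕ}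
    (ρ : MatSymbol k m) : block S S' hS' ρ = blk S S' hS' ρ.toWMat := rfl

section

variable {S S' : Set ℝ} {hS : MeasurableSet S} {hS' : MeasurableSet S'} {k l m : ℕ}

theorem blk_add (x y : WMat k m) :
    blk S S' hS' (x + y) = blk S S' hS' x + blk S S' hS' y := by
  simp only [blk, op_add, ContinuousLinearMap.add_comp, ContinuousLinearMap.comp_add]

theorem blk_one (f : Fin k → L1On S) : blk S S hS (1 : WMat k k) f = f := by
  rw [blk, op_one]
  exact restrCols_inclCols hS f

/-- Between the factors the identity is inserted as the sum of the two restrictions, so blocks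
multiply as in a 2×2 block matrix. -/
theorem blk_mul (h : Splits S S' hS hS') {R U : Set ℝ} {hU : MeasurableSet U}
    (x : WMat k l) (y : WMat l m) (f : Fin m → L1On R) :
    blk R U hU (x * y) f =
      blk S U hU x (blk R S hS y f) + blk S' U hU x (blk R S' hS' y f) := by
  simp only [blk, op_mul, ContinuousLinearMap.comp_apply]
  rw [← map_add, ← map_add, h.inclCols_add]

theorem blk_eq_zero (h : Splits S S' hS hS') {x : WMat k m}
    (hx : ∀ i j, ∀ f ∈ L1On S, Wiener.op (x i j) f ∈ L1On S) : blk S S' hS' x = 0 := by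
  ext1 f
  funext i
  refine Subtype.ext ((indic_eq_zero_iff h _).2 ?_)
  change op x (inclCols S m f) i ∈ L1On S
  rw [op_apply]
  exact Submodule.sum_mem _ fun j _ => hx i j _ (f j).2

end

section

variable {k m : ℕ}

/-- Convolution with a function on `ℝ₊` preserves `L¹(ℝ₊)`, so such a Laurent operator is block
triangular. -/
theorem blk_plus_minus {x : WMat k m} (hx : ∀ i j, x i j ∈ Wiener.plus) :
    blk (Ici 0) (Iic 0) measurableSet_Iic x = 0 :=
  blk_eq_zero splits_Ici_Iic fun i j _ hf =>
    L1Plus.add_mem (L1Plus.smul_mem _ hf) (conv_mem_plus (hx i j) hf)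

theorem blk_minus_plus {x : WMat k m} (hx : ∀ i j, x i j ∈ Wiener.minus) :
    blk (Iic 0) (Ici 0) measurableSet_Ici x = 0 :=
  blk_eq_zero splits_Ici_Iic.symm fun i j _ hf =>
    L1Minus.add_mem (L1Minus.smul_mem _ hf) (conv_mem_minus (hx i j) hf)

end

/-! ### The algebra of the blocks -/

section

variable {S S' : Set ℝ} {hS : MeasurableSet S} {hS' : MeasurableSet S'} {p q : ℕ}

/-- Write `X_S` for the compression of `X` to `S`. Replacing the path through `S'` in `G * C` by `(G
* C)_S - G_S C_S`, and likewise for `G * D`, turns the left side into `(A + GC)_S A'_S - (B + GD)_S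
B'_S - G_S (C_S A'_S - D_S B'_S)`. The vanishing blocks make every compression here multiplicative.
The first two terms become the compression of `AA' - BB' = 1`, and the bracket that of `CA' - DB' =
0`. -/
theorem right_inverse_diag (h : Splits S S' hS hS') {A A' : WMat p p} {B : WMat p q}
    {B' C : WMat q p} {D : WMat q q} {G : WMat p q}
    (h1 : A * A' = 1 + B * B') (h2 : C * A' = D * B')
    (hC : blk S' S hS C = 0) (hD : blk S' S hS D = 0)
    (hu : blk S' S hS (A + G * C) = 0) (hx : blk S' S hS (B + G * D) = 0)
    (f : Fin p → L1On S) :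
    blk S S hS A (blk S S hS A' f) - blk S S hS B (blk S S hS B' f) +
      blk S' S hS G (blk S S' hS' C (blk S S hS A' f) - blk S S' hS' D (blk S S hS B' f)) = f := by
  have e1 := blk_mul h (hU := hS) G C (blk S S hS A' f)
  have e2 := blk_mul h (hU := hS) G D (blk S S hS B' f)
  have e3 := blk_mul h (hU := hS) (A + G * C) A' f
  have e4 := blk_mul h (hU := hS) (B + G * D) B' f
  have e5 := congrArg (blk S S hS G) (blk_mul h (hU := hS) C A' f)
  have e6 := congrArg (blk S S hS G) (blk_mul h (hU := hS) D B' f)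
  -- The terms in `G` agree by `h2`, so `h1` survives unchanged.
  have e7 : (A + G * C) * A' = 1 + (B + G * D) * B' := by
    rw [Matrix.add_mul, Matrix.add_mul, h1, Matrix.mul_assoc, Matrix.mul_assoc, h2, add_assoc]
  rw [e7, blk_add, hu] at e3
  rw [hx] at e4
  rw [h2, hC] at e5
  rw [hD] at e6
  simp only [blk_add, add_apply, map_sub, blk_one, zero_apply, add_zero] at *
  linear_combination (norm := module) e5 - e6 - e1 + e2 - e3 + e4

/-- No relation between the symbols is needed: `A` and `B` preserve `S`, so `G'` composed with them
is a block of `G' * A` or `G' * B`, and these cancel against `C` and `D` by `hv` and `hw`. -/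
theorem right_inverse_offdiag (h : Splits S S' hS hS') {A A' : WMat p p} {B : WMat p q}
    {B' C G' : WMat q p} {D : WMat q q}
    (hA : blk S S' hS' A = 0) (hB : blk S S' hS' B = 0)
    (hv : blk S S' hS' (C + G' * A) = 0) (hw : blk S S' hS' (D + G' * B) = 0)
    (f : Fin p → L1On S) :
    blk S S' hS' G' (blk S S hS A (blk S S hS A' f) - blk S S hS B (blk S S hS B' f)) +
      (blk S S' hS' C (blk S S hS A' f) - blk S S' hS' D (blk S S hS B' f)) = 0 := by
  have e1 := blk_mul h (hU := hS') G' A (blk S S hS A' f)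
  have e2 := blk_mul h (hU := hS') G' B (blk S S hS B' f)
  have e3 := congrArg (fun T => T (blk S S hS A' f)) hv
  have e4 := congrArg (fun T => T (blk S S hS B' f)) hw
  rw [hA] at e1
  rw [hB] at e2
  simp only [blk_add, add_apply, map_sub, zero_apply,
    add_zero, map_zero] at *
  linear_combination (norm := module) e3 - e4 - e1 + e2

/-- Mirror image of `right_inverse_diag`: the correction by `G'` now enters the right-hand factors,
which must carry `S` into `S`. -/
theorem left_inverse_diag (h : Splits S S' hS hS') {A A' : WMat p p} {B C' : WMat p q}
    {B' G' : WMat q p} {D' : WMat q q}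
    (h1 : A * A' = 1 + B * B') (h2 : A * C' = B * D')
    (hC : blk S S' hS' C' = 0) (hD : blk S S' hS' D' = 0)
    (hu : blk S S' hS' (A' + C' * G') = 0) (hx : blk S S' hS' (B' + D' * G') = 0)
    (f : Fin p → L1On S) :
    blk S S hS A (blk S S hS A' f) - blk S S hS B (blk S S hS B' f) +
      (blk S S hS A (blk S' S hS C' (blk S S' hS' G' f)) -
        blk S S hS B (blk S' S hS D' (blk S S' hS' G' f))) = f := by
  have e1 := congrArg (blk S S hS A) (blk_mul h (hU := hS) C' G' f)
  have e2 := congrArg (blk S S hS B) (blk_mul h (hU := hS) D' G' f)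
  have e3 := blk_mul h (hU := hS) A (A' + C' * G') f
  have e4 := blk_mul h (hU := hS) B (B' + D' * G') f
  have e5 := blk_mul h (hU := hS) A C' (blk S S hS G' f)
  have e6 := blk_mul h (hU := hS) B D' (blk S S hS G' f)
  have e7 : A * (A' + C' * G') = 1 + B * (B' + D' * G') := by
    rw [Matrix.mul_add, Matrix.mul_add, h1, ← Matrix.mul_assoc, ← Matrix.mul_assoc, h2, add_assoc]
  rw [e7, blk_add, hu] at e3
  rw [hx] at e4
  rw [h2, hC] at e5
  rw [hD] at e6
  simp only [blk_add, add_apply, map_add, blk_one, zero_apply, add_zero, map_zero] at *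
  linear_combination (norm := module) e5 - e6 - e1 + e2 - e3 + e4

theorem left_inverse_offdiag (h : Splits S S' hS hS') {A A' : WMat p p} {B G C' : WMat p q}
    {B' : WMat q p} {D' : WMat q q}
    (hA : blk S' S hS A' = 0) (hB : blk S' S hS B' = 0)
    (hv : blk S' S hS (C' + A' * G) = 0) (hw : blk S' S hS (D' + B' * G) = 0)
    (f : Fin q → L1On S') :
    blk S S hS A (blk S S hS A' (blk S' S hS G f)) -
      blk S S hS B (blk S S hS B' (blk S' S hS G f)) +
      (blk S S hS A (blk S' S hS C' f) - blk S S hS B (blk S' S hS D' f)) = 0 := by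
  have e1 := congrArg (blk S S hS A) (blk_mul h (hU := hS) A' G f)
  have e2 := congrArg (blk S S hS B) (blk_mul h (hU := hS) B' G f)
  have e3 := congrArg (fun T => blk S S hS A (T f)) hv
  have e4 := congrArg (fun T => blk S S hS B (T f)) hw
  rw [hA] at e1
  rw [hB] at e2
  simp only [blk_add, add_apply, map_add, zero_apply,
    add_zero, map_zero] at *
  linear_combination (norm := module) e3 - e4 - e1 + e2

/-- Both sides come from expanding the same block of `A * C' = B * D'`. This moves the Hankel factor
from the left to the right, the form needed for the left inverse. -/
theorem offdiag_eq (h : Splits S S' hS hS') {A : WMat p p} {B C' : WMat p q} {D' : WMat q q}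
    (h2 : A * C' = B * D') (f : Fin q → L1On S') :
    blk S' S hS B (blk S' S' hS' D' f) - blk S' S hS A (blk S' S' hS' C' f) =
      blk S S hS A (blk S' S hS C' f) - blk S S hS B (blk S' S hS D' f) := by
  have e1 := blk_mul h (hU := hS) A C' f
  have e2 := blk_mul h (hU := hS) B D' f
  rw [h2] at e1
  linear_combination (norm := module) e1 - e2

end

end WMat

end EllisGohberg

namespace EllisGohberg

/-! ### Identities for the symbols -/

namespace WMat

variable {k l m : ℕ}

/-- All the entries of `x` belong to `X`. -/
def MemOf (X : Subring Wiener) (x : WMat k m) : Prop := ∀ i j, x i j ∈ X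

theorem MemOf.sub {X : Subring Wiener} {x y : WMat k m} (hx : MemOf X x) (hy : MemOf X y) :
    MemOf X (x - y) :=
  fun i j => X.sub_mem (hx i j) (hy i j)

theorem MemOf.mul {X : Subring Wiener} {x : WMat k l} {y : WMat l m} (hx : MemOf X x)
    (hy : MemOf X y) : MemOf X (x * y) :=
  fun i j => (Matrix.mul_apply (M := x) (N := y) (i := i) (k := j)).symm ▸
    X.sum_mem fun n _ => X.mul_mem (hx i n) (hy n j)

theorem MemOf.star_minus {x : WMat k m} (hx : MemOf Wiener.plus x) :
    MemOf Wiener.minus x.conjTranspose :=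
  fun i j => Wiener.star_mem_minus (hx j i)

theorem MemOf.star_plus {x : WMat k m} (hx : MemOf Wiener.minus x) :
    MemOf Wiener.plus x.conjTranspose :=
  fun i j => Wiener.star_mem_plus (hx j i)

/-- The constant term of a matrix over the Wiener algebra. -/
def cst (x : WMat k m) : Matrix (Fin k) (Fin m) ℂ := x.map (Unitization.fstHom ℂ ConvL1)

theorem cst_mul (x : WMat k l) (y : WMat l m) : cst (x * y) = cst x * cst y := Matrix.map_mul

theorem cst_sub (x y : WMat k m) : cst (x - y) = cst x - cst y :=
  Matrix.map_sub _ (map_sub _) x y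

theorem cst_conjTranspose (x : WMat k m) : cst x.conjTranspose = (cst x).conjTranspose := rfl

theorem ext_of_memOf {x y : WMat k m} (hp : MemOf Wiener.plus (x - y))
    (hm : MemOf Wiener.minus (x - y)) (hc : cst x = cst y) : x = y := by
  rw [← sub_eq_zero]
  ext1 i j
  rw [Wiener.eq_inl_of_mem (hp i j) (hm i j)]
  have h : cst (x - y) i j = 0 := by rw [cst_sub, hc, sub_self, Matrix.zero_apply]
  change Unitization.inl (cst (x - y) i j) = 0
  rw [h, Unitization.inl_zero]

theorem memOf_one (X : Subring Wiener) : MemOf X (1 : WMat k k) := by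
  intro i j
  rw [Matrix.one_apply]
  split_ifs
  · exact X.one_mem
  · exact X.zero_mem

theorem cst_one : cst (1 : WMat k k) = 1 := Matrix.map_one _ (map_zero _) (map_one _)

/-- Selfadjointness puts the entries in the opposite subalgebra as well, so only the constant term
remains. -/
theorem eq_one_of_isHermitian_of_plus {x : WMat k k} (hp : MemOf Wiener.plus x)
    (hx : x.conjTranspose = x) (hc : cst x = 1) : x = 1 :=
  ext_of_memOf (hp.sub (memOf_one _)) ((hx ▸ hp.star_minus : MemOf _ x).sub (memOf_one _))
    (hc.trans cst_one.symm)

theorem eq_one_of_isHermitian_of_minus {x : WMat k k} (hm : MemOf Wiener.minus x)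
    (hx : x.conjTranspose = x) (hc : cst x = 1) : x = 1 :=
  ext_of_memOf ((hx ▸ hm.star_plus : MemOf _ x).sub (memOf_one _)) (hm.sub (memOf_one _))
    (hc.trans cst_one.symm)

end WMat

open WMat

/-- The symbols `α = e + a`, `β = b`, `γ = c`, `δ = e + d` and `g` satisfy the inclusions of the
twofold Ellis–Gohberg inverse problem. -/
structure SymbolData {p q : ℕ} (α : WMat p p) (β : WMat p q) (γ : WMat q p) (δ : WMat q q)
    (g : WMat p q) : Prop where
  memA : MemOf Wiener.plus α
  memB : MemOf Wiener.plus β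
  memC : MemOf Wiener.minus γ
  memD : MemOf Wiener.minus δ
  cstA : cst α = 1
  cstB : cst β = 0
  cstC : cst γ = 0
  cstD : cst δ = 1
  incA : MemOf Wiener.minus (α + g * γ)
  incB : MemOf Wiener.minus (β + g * δ)
  incC : MemOf Wiener.plus (γ + g.conjTranspose * α)
  incD : MemOf Wiener.plus (δ + g.conjTranspose * β)

namespace SymbolData

open Matrix

variable {p q : ℕ} {α : WMat p p} {β : WMat p q} {γ : WMat q p} {δ : WMat q q} {g : WMat p q}

theorem star_mul_self_A (h : SymbolData α β γ δ g) : αᴴ * α - γᴴ * γ = 1 := by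
  -- The cross terms `αᴴ * g * γ` cancel.
  have e : αᴴ * α - γᴴ * γ = αᴴ * (α + g * γ) - (γ + gᴴ * α)ᴴ * γ := by
    rw [conjTranspose_add, conjTranspose_mul, conjTranspose_conjTranspose, Matrix.mul_add,
      Matrix.add_mul, Matrix.mul_assoc]
    abel
  apply eq_one_of_isHermitian_of_minus
  · rw [e]
    exact (h.memA.star_minus.mul h.incA).sub (h.incC.star_minus.mul h.memC)
  · simp
  · simp [cst_sub, cst_mul, cst_conjTranspose, h.cstA, h.cstC]

theorem star_mul_self_D (h : SymbolData α β γ δ g) : δᴴ * δ - βᴴ * β = 1 := by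
  have e : δᴴ * δ - βᴴ * β = δᴴ * (δ + gᴴ * β) - (β + g * δ)ᴴ * β := by
    rw [conjTranspose_add, conjTranspose_mul, Matrix.mul_add, Matrix.add_mul, Matrix.mul_assoc]
    abel
  apply eq_one_of_isHermitian_of_plus
  · rw [e]
    exact (h.memD.star_plus.mul h.incD).sub (h.incB.star_plus.mul h.memB)
  · simp
  · simp [cst_sub, cst_mul, cst_conjTranspose, h.cstD, h.cstB]

/-- The difference is not selfadjoint, so it is written in two ways: one visibly in the minus
algebra (`e1`), one in the plus algebra (`e2`). -/
theorem star_mul_AB (h : SymbolData α β γ δ g) : αᴴ * β = γᴴ * δ := by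
  have e1 : αᴴ * β - γᴴ * δ = αᴴ * (β + g * δ) - (γ + gᴴ * α)ᴴ * δ := by
    rw [conjTranspose_add, conjTranspose_mul, conjTranspose_conjTranspose, Matrix.mul_add,
      Matrix.add_mul, Matrix.mul_assoc]
    abel
  have e2 : αᴴ * β - γᴴ * δ = (α + g * γ)ᴴ * β - γᴴ * (δ + gᴴ * β) := by
    rw [conjTranspose_add, conjTranspose_mul, Matrix.mul_add, Matrix.add_mul, Matrix.mul_assoc]
    abel
  apply ext_of_memOf
  · rw [e2]
    exact (h.incA.star_plus.mul h.memB).sub (h.memC.star_plus.mul h.incD)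
  · rw [e1]
    exact (h.memA.star_minus.mul h.incB).sub (h.incC.star_minus.mul h.memD)
  · simp [cst_mul, cst_conjTranspose, h.cstB, h.cstC]

theorem fromBlocks_mul (h : SymbolData α β γ δ g) :
    fromBlocks α β γ δ * fromBlocks αᴴ (-γᴴ) (-βᴴ) δᴴ = 1 := by
  -- The identities already proved give the product in the reverse order; for square matrices over a
  -- commutative ring this suffices.
  rw [_root_.mul_eq_one_comm, fromBlocks_multiply, ← fromBlocks_one]
  have e := congrArg conjTranspose h.star_mul_AB
  simp only [conjTranspose_mul, conjTranspose_conjTranspose] at e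
  congr 1
  · rw [← h.star_mul_self_A, Matrix.neg_mul, sub_eq_add_neg]
  · rw [h.star_mul_AB, Matrix.neg_mul, add_neg_cancel]
  · rw [Matrix.neg_mul, e, neg_add_cancel]
  · rw [← h.star_mul_self_D, Matrix.neg_mul, sub_eq_neg_add]

theorem mul_star_A (h : SymbolData α β γ δ g) : α * αᴴ = 1 + β * βᴴ := by
  have := congrArg toBlocks₁₁ h.fromBlocks_mul
  rw [fromBlocks_multiply, ← fromBlocks_one, toBlocks_fromBlocks₁₁, toBlocks_fromBlocks₁₁,
    Matrix.mul_neg, ← sub_eq_add_neg] at this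
  exact sub_eq_iff_eq_add.1 this

theorem mul_star_AC (h : SymbolData α β γ δ g) : α * γᴴ = β * δᴴ := by
  have := congrArg toBlocks₁₂ h.fromBlocks_mul
  rw [fromBlocks_multiply, ← fromBlocks_one, toBlocks_fromBlocks₁₂, toBlocks_fromBlocks₁₂,
    Matrix.mul_neg, neg_add_eq_zero] at this
  exact this

theorem mul_star_CA (h : SymbolData α β γ δ g) : γ * αᴴ = δ * βᴴ := by
  have := congrArg conjTranspose h.mul_star_AC
  simpa only [conjTranspose_mul, conjTranspose_conjTranspose] using this

theorem mul_star_D (h : SymbolData α β γ δ g) : δ * δᴴ = 1 + γ * γᴴ := by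
  have := congrArg toBlocks₂₂ h.fromBlocks_mul
  rw [fromBlocks_multiply, ← fromBlocks_one, toBlocks_fromBlocks₂₂, toBlocks_fromBlocks₂₂,
    Matrix.mul_neg, neg_add_eq_sub] at this
  exact sub_eq_iff_eq_add.1 this

theorem incA_star (h : SymbolData α β γ δ g) : MemOf Wiener.plus (αᴴ + γᴴ * gᴴ) := by
  simpa using h.incA.star_plus

theorem incB_star (h : SymbolData α β γ δ g) : MemOf Wiener.plus (βᴴ + δᴴ * gᴴ) := by
  simpa using h.incB.star_plus

theorem incC_star (h : SymbolData α β γ δ g) : MemOf Wiener.minus (γᴴ + αᴴ * g) := by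
  simpa using h.incC.star_minus

theorem incD_star (h : SymbolData α β γ δ g) : MemOf Wiener.minus (δᴴ + βᴴ * g) := by
  simpa using h.incD.star_minus

end SymbolData

/-! ### The equations for the data -/

namespace Wiener

/-- `fn` as an additive map. -/
def fnHom : Wiener →+ L1R := ⟨⟨fn, fn_zero⟩, fn_add⟩

theorem ext_fn {x y : Wiener} (h1 : x.fst = y.fst) (h2 : fn x = fn y) : x = y :=
  Unitization.ext h1 h2

end Wiener

theorem MatSymbol.toWMat_add {k m : ℕ} (ρ σ : MatSymbol k m) :
    ρ.toWMat + σ.toWMat = (⟨ρ.const + σ.const, ρ.fn + σ.fn⟩ : MatSymbol k m).toWMat := rfl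

theorem MatSymbol.toWMat_ofL1_mul {k l m : ℕ} (r : L1Mat k l) (σ : MatSymbol l m) :
    (ofL1 r).toWMat * σ.toWMat =
      (ofL1 (Matrix.of (fun i j => ∑ n, σ.const n j • r i n) + mconv r σ.fn)).toWMat := by
  ext1 i j
  rw [Matrix.mul_apply]
  apply Wiener.ext_fn
  · change Unitization.fstHom ℂ ConvL1 _ = 0
    rw [map_sum]
    exact Finset.sum_eq_zero fun n _ => zero_mul _
  · change Wiener.fnHom _ = _
    rw [map_sum]
    change ∑ n, ((0 : ℂ) • σ.fn n j + σ.const n j • r i n + conv (r i n) (σ.fn n j)) =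
      ∑ n, σ.const n j • r i n + ∑ n, conv (r i n) (σ.fn n j)
    simp only [zero_smul, zero_add, Finset.sum_add_distrib]

theorem MatSymbol.toWMat_ofL1_mul_ofL1 {k l m : ℕ} (r : L1Mat k l) (s : L1Mat l m) :
    (ofL1 r).toWMat * (ofL1 s).toWMat = (ofL1 (mconv r s)).toWMat := by
  rw [toWMat_ofL1_mul]
  congr 2
  refine add_eq_right.2 ?_
  ext1 i j
  change ∑ n, (0 : ℂ) • r i n = 0
  exact Finset.sum_eq_zero fun n _ => zero_smul ℂ (r i n)

/-- The unit in the second factor accounts for the isolated `g` and `g*` in the inclusions. -/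
theorem MatSymbol.toWMat_ofL1_mul_oneAdd {k m : ℕ} (r : L1Mat k m) (s : L1Mat m m) :
    (ofL1 r).toWMat * (oneAdd s).toWMat = (ofL1 (r + mconv r s)).toWMat := by
  rw [toWMat_ofL1_mul]
  congr 3
  ext1 i j
  change ∑ n, (1 : Matrix (Fin m) (Fin m) ℂ) n j • r i n = r i j
  simp [Matrix.one_apply]

theorem MatSymbol.adjoint_ofL1 {k m : ℕ} (r : L1Mat k m) : (ofL1 r).adjoint = ofL1 (adj r) := by
  rw [adjoint, ofL1, ofL1, Matrix.conjTranspose_zero]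

theorem IsEGSolution.symbolData {p q : ℕ} {a : L1PlusMat p p} {b : L1PlusMat p q}
    {c : L1MinusMat q p} {d : L1MinusMat q q} {g : L1PlusMat p q} (h : IsEGSolution a b c d g) :
    SymbolData (symA a).toWMat (symB b).toWMat (symC c).toWMat (symD d).toWMat
      (MatSymbol.ofL1 (incl g)).toWMat where
  memA i j := (a i j).2
  memB i j := (b i j).2
  memC i j := (c i j).2
  memD i j := (d i j).2
  cstA := rfl
  cstB := rfl
  cstC := rfl
  cstD := rfl
  incA := by
    rw [symA, symC, MatSymbol.toWMat_ofL1_mul_ofL1, MatSymbol.toWMat_add]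
    exact h.inclusion_a
  incB := by
    rw [symB, symD, MatSymbol.toWMat_ofL1_mul_oneAdd, MatSymbol.toWMat_add]
    have h' := h.inclusion_b
    rw [add_comm] at h'
    exact h'
  incC := by
    rw [symA, symC, ← MatSymbol.toWMat_adjoint, MatSymbol.adjoint_ofL1,
      MatSymbol.toWMat_ofL1_mul_oneAdd, MatSymbol.toWMat_add]
    have h' := h.inclusion_c
    rw [add_comm] at h'
    exact h'
  incD := by
    rw [symB, symD, ← MatSymbol.toWMat_adjoint, MatSymbol.adjoint_ofL1,
      MatSymbol.toWMat_ofL1_mul_ofL1, MatSymbol.toWMat_add]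
    exact h.inclusion_d

theorem block_ofL1_apply {S S' : Set ℝ} (hS' : MeasurableSet S') {k l m : ℕ} (r : L1Mat k l)
    (y : Matrix (Fin l) (Fin m) (L1On S)) (i : Fin k) (j : Fin m) :
    (block S S' hS' (MatSymbol.ofL1 r) (fun n => y n j) i : L1R) =
      indic S' hS' (mconv r (incl y) i j) := by
  rw [block_eq_blk]
  change indic S' hS' (op _ (inclCols S l fun n => y n j) i) = _
  rw [op_apply]
  congr 1
  refine Finset.sum_congr rfl fun n _ => ?_
  change (0 : ℂ) • (y n j : L1R) + conv (r i n) (y n j) = _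
  rw [zero_smul, zero_add]
  rfl

/-- Since `x` and `u` live on `S`, the equation says that the restriction to `S` of `x + r ⋆ y - u`
vanishes, that is, that this function is supported in `S'`. -/
theorem add_block_eq_iff {S S' : Set ℝ} {hS : MeasurableSet S} {hS' : MeasurableSet S'}
    (h : Splits S S' hS hS') {k l m : ℕ} (r : L1Mat k l) (x u : Matrix (Fin k) (Fin m) (L1On S))
    (y : Matrix (Fin l) (Fin m) (L1On S')) (j : Fin m) :
    (fun i => x i j) + block S' S hS (MatSymbol.ofL1 r) (fun n => y n j) = (fun i => u i j) ↔
      ∀ i, (incl x + mconv r (incl y) - incl u) i j ∈ L1On S' := by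
  rw [funext_iff]
  refine forall_congr' fun i => ?_
  have hadd (f f' : L1R) : indic S hS (f + f') = indic S hS f + indic S hS f' := indic_add S hS f f'
  have e1 : (incl x + mconv r (incl y) - incl u) i j =
      mconv r (incl y) i j + ((x i j - u i j : L1On S) : L1R) := by
    change (x i j : L1R) + mconv r (incl y) i j - (u i j : L1R) = _
    rw [Submodule.coe_sub]
    abel
  rw [← indic_eq_zero_iff h.symm, e1, hadd, indic_of_mem hS (x i j - u i j).2,
    ← block_ofL1_apply hS r y i j, ← Submodule.coe_add, Submodule.coe_eq_zero,
    ← sub_eq_zero (b := u i j), Pi.add_apply]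
  exact iff_of_eq (congrArg (· = 0) (by abel))

theorem blockEq_W_iff {p q m : ℕ} (g : L1PlusMat p q) (x u : L1PlusMat p m) (y v : L1MinusMat q m) :
    BlockEq (W g) x y u v ↔
      SuppIn (Iic 0) (incl x + mconv (incl g) (incl y) - incl u) ∧
        SuppIn (Ici 0) (incl y + mconv (adj (incl g)) (incl x) - incl v) := by
  have key (j : Fin m) : W g (fun i => x i j, fun i => y i j) = (fun i => u i j, fun i => v i j) ↔
      (∀ i, (incl x + mconv (incl g) (incl y) - incl u) i j ∈ L1Minus) ∧
        ∀ i, (incl y + mconv (adj (incl g)) (incl x) - incl v) i j ∈ L1Plus := by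
    rw [← add_block_eq_iff splits_Ici_Iic, ← add_block_eq_iff splits_Ici_Iic.symm, Prod.ext_iff,
      add_comm (fun i => y i j)]
    rfl
  simp only [BlockEq, key, SuppIn]
  exact ⟨fun h => ⟨fun i j => (h j).1 i, fun i j => (h j).2 i⟩,
    fun h j => ⟨fun i => h.1 i j, fun i => h.2 i j⟩⟩

theorem isEGSolution_iff {p q : ℕ} (a : L1PlusMat p p) (b : L1PlusMat p q)
    (c : L1MinusMat q p) (d : L1MinusMat q q) (g : L1PlusMat p q) :
    IsEGSolution a b c d g ↔
      BlockEq (W g) a c 0 (-adjPlus g) ∧ BlockEq (W g) b d (-g) 0 := by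
  have z1 : incl (0 : L1PlusMat p p) = 0 := rfl
  have z2 : incl (0 : L1MinusMat q q) = 0 := rfl
  have n1 : incl (-g) = -incl g := rfl
  have n2 : incl (-adjPlus g) = -adj (incl g) := rfl
  rw [blockEq_W_iff, blockEq_W_iff, z1, z2, n1, n2, sub_zero, sub_zero, sub_neg_eq_add,
    sub_neg_eq_add]
  have e1 : incl c + mconv (adj (incl g)) (incl a) + adj (incl g) =
      adj (incl g) + mconv (adj (incl g)) (incl a) + incl c := by abel
  have e2 : incl b + mconv (incl g) (incl d) + incl g =
      incl g + mconv (incl g) (incl d) + incl b := by abel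
  rw [e1, e2]
  exact ⟨fun h => ⟨⟨h.1, h.2⟩, h.4, h.3⟩, fun h => ⟨h.1.1, h.1.2, h.2.2, h.2.1⟩⟩

/-! ### The inverse of `W` -/

open WMat Matrix

section

variable {p q : ℕ} (a : L1PlusMat p p) (b : L1PlusMat p q) (c : L1MinusMat q p)
  (d : L1MinusMat q q) (g : L1PlusMat p q)

theorem Hg_eq : Hg g = blk (Iic 0) (Ici 0) measurableSet_Ici (MatSymbol.ofL1 (incl g)).toWMat := rfl

theorem HgStar_eq : HgStar g =
    blk (Ici 0) (Iic 0) measurableSet_Iic (MatSymbol.ofL1 (incl g)).toWMatᴴ := by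
  rw [← MatSymbol.toWMat_adjoint, MatSymbol.adjoint_ofL1]
  rfl

theorem M11_apply (f : Fin p → L1Plus) : M11 a b f =
    blk (Ici 0) (Ici 0) measurableSet_Ici (symA a).toWMat
        (blk (Ici 0) (Ici 0) measurableSet_Ici (symA a).toWMatᴴ f) -
      blk (Ici 0) (Ici 0) measurableSet_Ici (symB b).toWMat
        (blk (Ici 0) (Ici 0) measurableSet_Ici (symB b).toWMatᴴ f) := by
  rw [M11, _root_.sub_apply]
  rfl

theorem M21_apply (f : Fin p → L1Plus) : M21 a b c d f =
    blk (Ici 0) (Iic 0) measurableSet_Iic (symC c).toWMat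
        (blk (Ici 0) (Ici 0) measurableSet_Ici (symA a).toWMatᴴ f) -
      blk (Ici 0) (Iic 0) measurableSet_Iic (symD d).toWMat
        (blk (Ici 0) (Ici 0) measurableSet_Ici (symB b).toWMatᴴ f) := by
  rw [M21, _root_.sub_apply]
  rfl

theorem M12_apply (f : Fin q → L1Minus) : M12 a b c d f =
    blk (Iic 0) (Ici 0) measurableSet_Ici (symB b).toWMat
        (blk (Iic 0) (Iic 0) measurableSet_Iic (symD d).toWMatᴴ f) -
      blk (Iic 0) (Ici 0) measurableSet_Ici (symA a).toWMat
        (blk (Iic 0) (Iic 0) measurableSet_Iic (symC c).toWMatᴴ f) := by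
  rw [M12, _root_.sub_apply]
  rfl

theorem M22_apply (f : Fin q → L1Minus) : M22 c d f =
    blk (Iic 0) (Iic 0) measurableSet_Iic (symD d).toWMat
        (blk (Iic 0) (Iic 0) measurableSet_Iic (symD d).toWMatᴴ f) -
      blk (Iic 0) (Iic 0) measurableSet_Iic (symC c).toWMat
        (blk (Iic 0) (Iic 0) measurableSet_Iic (symC c).toWMatᴴ f) := by
  rw [M22, _root_.sub_apply]
  rfl

end

theorem IsEGSolution.right_inverse {p q : ℕ} {a : L1PlusMat p p} {b : L1PlusMat p q}
    {c : L1MinusMat q p} {d : L1MinusMat q q} {g : L1PlusMat p q} (h : IsEGSolution a b c d g) :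
    (∀ f, M11 a b f + Hg g (M21 a b c d f) = f) ∧
    (∀ f, HgStar g (M11 a b f) + M21 a b c d f = 0) ∧
    (∀ f, M22 c d f + HgStar g (M12 a b c d f) = f) ∧
    (∀ f, Hg g (M22 c d f) + M12 a b c d f = 0) := by
  have H := h.symbolData
  have sp := splits_Ici_Iic
  have sm := splits_Ici_Iic.symm
  refine ⟨fun f => ?_, fun f => ?_, fun f => ?_, fun f => ?_⟩
  · rw [M11_apply, M21_apply, Hg_eq]
    exact right_inverse_diag sp H.mul_star_A H.mul_star_CA (blk_minus_plus H.memC)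
      (blk_minus_plus H.memD) (blk_minus_plus H.incA) (blk_minus_plus H.incB) f
  · rw [M11_apply, M21_apply, HgStar_eq]
    exact right_inverse_offdiag sp (blk_plus_minus H.memA)
      (blk_plus_minus H.memB) (blk_plus_minus H.incC) (blk_plus_minus H.incD) f
  -- Exchanging the half-lines swaps `α` with `δ`, `β` with `γ` and `g` with `g*`.
  · rw [M22_apply, M12_apply, HgStar_eq]
    exact right_inverse_diag sm H.mul_star_D H.mul_star_AC.symm (blk_plus_minus H.memB)
      (blk_plus_minus H.memA) (blk_plus_minus H.incD) (blk_plus_minus H.incC) f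
  · rw [M22_apply, M12_apply, Hg_eq]
    exact right_inverse_offdiag sm (blk_minus_plus H.memD)
      (blk_minus_plus H.memC) (blk_minus_plus H.incB) (blk_minus_plus H.incA) f

theorem IsEGSolution.left_inverse {p q : ℕ} {a : L1PlusMat p p} {b : L1PlusMat p q}
    {c : L1MinusMat q p} {d : L1MinusMat q q} {g : L1PlusMat p q} (h : IsEGSolution a b c d g) :
    (∀ f, M11 a b f + M12 a b c d (HgStar g f) = f) ∧
    (∀ f, M11 a b (Hg g f) + M12 a b c d f = 0) ∧
    (∀ f, M22 c d f + M21 a b c d (Hg g f) = f) ∧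
    (∀ f, M22 c d (HgStar g f) + M21 a b c d f = 0) := by
  have H := h.symbolData
  have sp := splits_Ici_Iic
  have sm := splits_Ici_Iic.symm
  -- For the left inverse, `M₁₂` and `M₂₁` are used with their Wiener–Hopf factors on the left.
  have m12 (f) := (M12_apply a b c d f).trans
    (offdiag_eq (hS := measurableSet_Ici) sp H.mul_star_AC f)
  have m21 (f) := (M21_apply a b c d f).trans
    (offdiag_eq (hS := measurableSet_Iic) sm H.mul_star_CA.symm f)
  refine ⟨fun f => ?_, fun f => ?_, fun f => ?_, fun f => ?_⟩
  · rw [M11_apply, m12, HgStar_eq]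
    exact left_inverse_diag sp H.mul_star_A H.mul_star_AC (blk_plus_minus H.memC.star_plus)
      (blk_plus_minus H.memD.star_plus) (blk_plus_minus H.incA_star) (blk_plus_minus H.incB_star) f
  · rw [M11_apply, m12, Hg_eq]
    exact left_inverse_offdiag sp (blk_minus_plus H.memA.star_minus)
      (blk_minus_plus H.memB.star_minus) (blk_minus_plus H.incC_star)
      (blk_minus_plus H.incD_star) f
  · rw [M22_apply, m21, Hg_eq]
    exact left_inverse_diag sm H.mul_star_D H.mul_star_CA.symm (blk_minus_plus H.memB.star_minus)
      (blk_minus_plus H.memA.star_minus) (blk_minus_plus H.incD_star)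
      (blk_minus_plus H.incC_star) f
  · rw [M22_apply, m21, HgStar_eq]
    exact left_inverse_offdiag sm (blk_plus_minus H.memD.star_plus)
      (blk_plus_minus H.memC.star_plus) (blk_plus_minus H.incB_star)
      (blk_plus_minus H.incA_star) f

end EllisGohberg

/-! ### Invertibility of `W`, Schur complements and recovery of `g` -/

namespace EllisGohberg

variable {p q : ℕ}

theorem W_apply (g : L1PlusMat p q) (x : Fin p → L1Plus) (y : Fin q → L1Minus) :
    W g (x, y) = (x + Hg g y, HgStar g x + y) := rfl

theorem blockOp_apply (A : (Fin p → L1Plus) →L[ℂ] (Fin p → L1Plus))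
    (B : (Fin q → L1Minus) →L[ℂ] (Fin p → L1Plus)) (C : (Fin p → L1Plus) →L[ℂ] (Fin q → L1Minus))
    (D : (Fin q → L1Minus) →L[ℂ] (Fin q → L1Minus)) (x : Fin p → L1Plus) (y : Fin q → L1Minus) :
    blockOp A B C D (x, y) = (A x + B y, C x + D y) := rfl

theorem exists_blockEq_of_surjective {m : ℕ} {T : Space p q →L[ℂ] Space p q}
    (hT : Function.Surjective T) (u : L1PlusMat p m) (v : L1MinusMat q m) :
    ∃ (x : L1PlusMat p m) (y : L1MinusMat q m), BlockEq T x y u v := by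
  choose z hz using fun j : Fin m => hT (fun i => u i j, fun i => v i j)
  exact ⟨Matrix.of fun i j => (z j).1 i, Matrix.of fun i j => (z j).2 i, hz⟩

section

variable {a : L1PlusMat p p} {b : L1PlusMat p q} {c : L1MinusMat q p} {d : L1MinusMat q q}
  {g : L1PlusMat p q}

theorem IsEGSolution.W_comp (h : IsEGSolution a b c d g) :
    W g ∘L blockOp (M11 a b) (M12 a b c d) (M21 a b c d) (M22 c d) =
      ContinuousLinearMap.id ℂ _ := by
  obtain ⟨h1, h2, h3, h4⟩ := h.right_inverse
  refine ContinuousLinearMap.ext fun ⟨x, y⟩ => ?_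
  rw [ContinuousLinearMap.comp_apply, blockOp_apply, W_apply, ContinuousLinearMap.id_apply]
  refine Prod.ext ?_ ?_
  · change M11 a b x + M12 a b c d y + Hg g (M21 a b c d x + M22 c d y) = x
    rw [map_add]
    linear_combination (norm := module) h1 x + h4 y
  · change HgStar g (M11 a b x + M12 a b c d y) + (M21 a b c d x + M22 c d y) = y
    rw [map_add]
    linear_combination (norm := module) h2 x + h3 y

theorem IsEGSolution.comp_W (h : IsEGSolution a b c d g) :
    blockOp (M11 a b) (M12 a b c d) (M21 a b c d) (M22 c d) ∘L W g =
      ContinuousLinearMap.id ℂ _ := by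
  obtain ⟨h1, h2, h3, h4⟩ := h.left_inverse
  refine ContinuousLinearMap.ext fun ⟨x, y⟩ => ?_
  rw [ContinuousLinearMap.comp_apply, W_apply, blockOp_apply, ContinuousLinearMap.id_apply]
  refine Prod.ext ?_ ?_
  · change M11 a b (x + Hg g y) + M12 a b c d (HgStar g x + y) = x
    rw [map_add, map_add]
    linear_combination (norm := module) h1 x + h2 y
  · change M21 a b c d (x + Hg g y) + M22 c d (HgStar g x + y) = y
    rw [map_add, map_add]
    linear_combination (norm := module) h4 x + h3 y

theorem IsEGSolution.isInvertible (h : IsEGSolution a b c d g) : (W g).IsInvertible :=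
  .of_inverse h.W_comp h.comp_W

/-- The inverse of `M₁₁` is the Schur complement of the second diagonal entry of `W`. -/
theorem IsEGSolution.M11_comp (h : IsEGSolution a b c d g) :
    M11 a b ∘L (ContinuousLinearMap.id ℂ _ - Hg g ∘L HgStar g) = ContinuousLinearMap.id ℂ _ := by
  ext1 x
  rw [ContinuousLinearMap.comp_apply, sub_apply, map_sub, ContinuousLinearMap.id_apply,
    ContinuousLinearMap.comp_apply]
  linear_combination (norm := module) h.left_inverse.1 x - h.left_inverse.2.1 (HgStar g x)

theorem IsEGSolution.comp_M11 (h : IsEGSolution a b c d g) :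
    (ContinuousLinearMap.id ℂ _ - Hg g ∘L HgStar g) ∘L M11 a b = ContinuousLinearMap.id ℂ _ := by
  ext1 x
  have e := congrArg (Hg g) (h.right_inverse.2.1 x)
  rw [map_add, map_zero] at e
  rw [ContinuousLinearMap.comp_apply, sub_apply, ContinuousLinearMap.id_apply,
    ContinuousLinearMap.id_apply, ContinuousLinearMap.comp_apply]
  linear_combination (norm := module) h.right_inverse.1 x - e

/-- The inverse of `M₂₂` is the Schur complement of the first diagonal entry of `W`. -/
theorem IsEGSolution.M22_comp (h : IsEGSolution a b c d g) :
    M22 c d ∘L (ContinuousLinearMap.id ℂ _ - HgStar g ∘L Hg g) = ContinuousLinearMap.id ℂ _ := by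
  ext1 x
  rw [ContinuousLinearMap.comp_apply, sub_apply, map_sub, ContinuousLinearMap.id_apply,
    ContinuousLinearMap.comp_apply]
  linear_combination (norm := module) h.left_inverse.2.2.1 x - h.left_inverse.2.2.2 (Hg g x)

theorem IsEGSolution.comp_M22 (h : IsEGSolution a b c d g) :
    (ContinuousLinearMap.id ℂ _ - HgStar g ∘L Hg g) ∘L M22 c d = ContinuousLinearMap.id ℂ _ := by
  ext1 x
  have e := congrArg (HgStar g) (h.right_inverse.2.2.2 x)
  rw [map_add, map_zero] at e
  rw [ContinuousLinearMap.comp_apply, sub_apply, ContinuousLinearMap.id_apply,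
    ContinuousLinearMap.id_apply, ContinuousLinearMap.comp_apply]
  linear_combination (norm := module) h.right_inverse.2.2.1 x - e

theorem IsEGSolution.M11_isInvertible (h : IsEGSolution a b c d g) : (M11 a b).IsInvertible :=
  .of_inverse h.M11_comp h.comp_M11

theorem IsEGSolution.M22_isInvertible (h : IsEGSolution a b c d g) : (M22 c d).IsInvertible :=
  .of_inverse h.M22_comp h.comp_M22

/-- An off-diagonal entry of the left inverse relation, `M₁₁ H + M₁₂ = 0`; the right inverse
relation gives the version with `M₂₂` on the right. -/
theorem IsEGSolution.Hg_eq_left (h : IsEGSolution a b c d g) :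
    Hg g = -((M11 a b).inverse ∘L M12 a b c d) := by
  ext1 f
  rw [neg_apply, ContinuousLinearMap.comp_apply, ← map_neg, eq_comm,
    h.M11_isInvertible.inverse_apply_eq, neg_eq_iff_add_eq_zero, add_comm]
  exact h.left_inverse.2.1 f

theorem IsEGSolution.Hg_eq_right (h : IsEGSolution a b c d g) :
    Hg g = -(M12 a b c d ∘L (M22 c d).inverse) := by
  ext1 f
  have e := h.right_inverse.2.2.2 ((M22 c d).inverse f)
  rw [h.M22_isInvertible.self_apply_inverse] at e
  exact eq_neg_of_add_eq_zero_left e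

theorem IsEGSolution.HgStar_eq_right (h : IsEGSolution a b c d g) :
    HgStar g = -(M21 a b c d ∘L (M11 a b).inverse) := by
  ext1 f
  have e := h.right_inverse.2.1 ((M11 a b).inverse f)
  rw [h.M11_isInvertible.self_apply_inverse] at e
  exact eq_neg_of_add_eq_zero_left e

theorem IsEGSolution.HgStar_eq_left (h : IsEGSolution a b c d g) :
    HgStar g = -((M22 c d).inverse ∘L M21 a b c d) := by
  ext1 f
  rw [neg_apply, ContinuousLinearMap.comp_apply, ← map_neg, eq_comm,
    h.M22_isInvertible.inverse_apply_eq, neg_eq_iff_add_eq_zero, add_comm]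
  exact h.left_inverse.2.2.2 f

/-- The inverse of `W` sends each column of `(-g, 0)` to that of `(b, d)`; the top component reads
`M₁₁(-g) = b`. -/
theorem IsEGSolution.eq_onCols (h : IsEGSolution a b c d g) :
    g = -onCols (M11 a b).inverse b := by
  have hb := ((isEGSolution_iff a b c d g).1 h).2
  ext1 i j
  have e := congrArg Prod.fst (DFunLike.congr_fun h.comp_W (fun i => b i j, fun i => d i j))
  rw [ContinuousLinearMap.comp_apply, hb j, blockOp_apply] at e
  have e' : M11 a b (fun i => -g i j) + M12 a b c d 0 = fun i => b i j := e
  rw [map_zero, add_zero] at e'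
  have e2 := congrFun ((h.M11_isInvertible.inverse_apply_eq).2 e'.symm) i
  change g i j = -(M11 a b).inverse (fun n => b n j) i
  rw [e2, neg_neg]

theorem IsEGSolution.adjPlus_eq_onCols (h : IsEGSolution a b c d g) :
    adjPlus g = -onCols (M22 c d).inverse c := by
  have hc := ((isEGSolution_iff a b c d g).1 h).1
  ext1 i j
  have e := congrArg Prod.snd (DFunLike.congr_fun h.comp_W (fun i => a i j, fun i => c i j))
  rw [ContinuousLinearMap.comp_apply, hc j, blockOp_apply] at e
  have e' : M21 a b c d 0 + M22 c d (fun i => -adjPlus g i j) = fun i => c i j := e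
  rw [map_zero, zero_add] at e'
  have e2 := congrFun ((h.M22_isInvertible.inverse_apply_eq).2 e'.symm) i
  change adjPlus g i j = -(M22 c d).inverse (fun n => c n j) i
  rw [e2, neg_neg]

end

end EllisGohberg

end

theorem theorem1p1 (p q : ℕ) (g : L1PlusMat p q) :
    ((W g).IsInvertible ↔
      ∃ (a : L1PlusMat p p) (b : L1PlusMat p q) (c : L1MinusMat q p) (d : L1MinusMat q q),
        IsEGSolution a b c d g) ∧
    ((W g).IsInvertible ↔
      (∃ (a : L1PlusMat p p) (c : L1MinusMat q p), BlockEq (W g) a c 0 (-adjPlus g)) ∧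
      (∃ (b : L1PlusMat p q) (d : L1MinusMat q q), BlockEq (W g) b d (-g) 0)) ∧
    ∀ (a : L1PlusMat p p) (b : L1PlusMat p q) (c : L1MinusMat q p) (d : L1MinusMat q q),
      BlockEq (W g) a c 0 (-adjPlus g) → BlockEq (W g) b d (-g) 0 →
        (W g).IsInvertible ∧
        (W g).inverse = blockOp (M11 a b) (M12 a b c d) (M21 a b c d) (M22 c d) ∧
        (M11 a b).IsInvertible ∧ (M22 c d).IsInvertible ∧
        Hg g = -((M11 a b).inverse ∘L M12 a b c d) ∧
        Hg g = -(M12 a b c d ∘L (M22 c d).inverse) ∧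
        HgStar g = -(M21 a b c d ∘L (M11 a b).inverse) ∧
        HgStar g = -((M22 c d).inverse ∘L M21 a b c d) ∧
        g = -onCols (M11 a b).inverse b ∧
        adjPlus g = -onCols (M22 c d).inverse c := by
  -- Surjectivity alone solves both equations, column by column.
  have solvable (hW : (W g).IsInvertible) :
      (∃ (a : L1PlusMat p p) (c : L1MinusMat q p), BlockEq (W g) a c 0 (-adjPlus g)) ∧
        ∃ (b : L1PlusMat p q) (d : L1MinusMat q q), BlockEq (W g) b d (-g) 0 :=
    ⟨exists_blockEq_of_surjective hW.surjective _ _,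
      exists_blockEq_of_surjective hW.surjective _ _⟩
  refine ⟨⟨fun hW => ?_, ?_⟩, ⟨solvable, ?_⟩, fun a b c d hac hbd => ?_⟩
  · obtain ⟨⟨a, c, hac⟩, b, d, hbd⟩ := solvable hW
    exact ⟨a, b, c, d, (isEGSolution_iff a b c d g).2 ⟨hac, hbd⟩⟩
  · rintro ⟨a, b, c, d, h⟩
    exact h.isInvertible
  · rintro ⟨⟨a, c, hac⟩, b, d, hbd⟩
    exact ((isEGSolution_iff a b c d g).2 ⟨hac, hbd⟩).isInvertible
  · have h := (isEGSolution_iff a b c d g).2 ⟨hac, hbd⟩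
    exact ⟨h.isInvertible, ContinuousLinearMap.inverse_eq h.W_comp h.comp_W, h.M11_isInvertible,
      h.M22_isInvertible, h.Hg_eq_left, h.Hg_eq_right, h.HgStar_eq_right, h.HgStar_eq_left,
      h.eq_onCols, h.adjPlus_eq_onCols⟩
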